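/- Let $R$ be a commutative Noetherian local Cohen--Macaulay ring of dimension $1$ with total ring of fractions $Q(R)$, and assume that $R$ is generically Gorenstein, i.e. $R_{\mathfrak p}$ is Gorenstein for every associated prime $\mathfrak p$ of $R$. Let $R\subseteq S\subseteq Q(R)$ be a ring extension such that $S$ is finitely generated as an $R$-module, and assume that $S$ is a Gorenstein ring. Let $\operatorname{CM}(S)$ be the class of maximal Cohen--Macaulay $S$-modules, that is, finitely generated $S$-modules $M$ with $\operatorname{depth} M_{\mathfrak n}\ge\dim S_{\mathfrak n}$ for all maximal ideals $\mathfrak n$ of $S$ (where $\operatorname{depth} 0=\infty$), regarded as $R$-modules by restriction of scalars. Let $\operatorname{refl}(R)$ be the class of finitely generated reflexive $R$-modules. For an $R$-module $M$ let $\operatorname{tr}_R(M)=\sum_{f\in\operatorname{Hom}_R(M,R)}f(M)$ be its trace ideal, and let $\mathfrak c_R(S)=\{a\in Q(R): aS\subseteq R\}$ be the conductor, which is an ideal of $R$. An ideal $I$ of $R$ is called stable if it contains a non-zero-divisor of $R$ and $I\cong\operatorname{Hom}_R(I,I)$ as $R$-modules. Then the following are equivalent: \begin{enumerate} \item $\operatorname{CM}(S)\subseteq\operatorname{refl}(R)$;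 \item $S\cong\operatorname{Hom}_R(S,R)$ as $R$-modules; \item $S\in\operatorname{refl}(R)$, and $\mathfrak c_R(S)$ is a stable ideal of $R$; \item $\operatorname{CM}(S)=\{M\in\operatorname{refl}(R): \operatorname{tr}_R(M)\subseteq\mathfrak c_R(S)\}$. \end{enumerate} -/

import Mathlib

universe u

namespace BirationalExt

/-- The depth of a module over a local ring: the supremum of the lengths of sequences in the
maximal ideal that are weakly regular on `M`. For a nonzero finitely generated module over a
Noetherian local ring, weakly regular sequences in the maximal ideal are regular, by Nakayama,
so this is the usual depth; the zero module has depth `⊤`. -/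
noncomputable def depth (A : Type*) [CommRing A] [IsLocalRing A]
    (M : Type*) [AddCommGroup M] [Module A M] : ℕ∞ :=
  ⨆ (rs : List A) (_ : ∀ r ∈ rs, r ∈ IsLocalRing.maximalIdeal A)
    (_ : RingTheory.Sequence.IsWeaklyRegular M rs), (rs.length : ℕ∞)

/-- A Cohen-Macaulay local ring. -/
def IsCohenMacaulayLocalRing (A : Type*) [CommRing A] [IsLocalRing A] : Prop :=
  IsNoetherianRing A ∧ ((depth A A : ℕ∞) : WithBot ℕ∞) = ringKrullDim A

/-- A Gorenstein local ring: Noetherian and of finite injective dimension over itself. -/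
def IsGorensteinLocalRing (A : Type u) [CommRing A] [IsLocalRing A] : Prop :=
  IsNoetherianRing A ∧
    ∃ n : ℕ, CategoryTheory.HasInjectiveDimensionLE (ModuleCat.of A A) n

/-- A Gorenstein ring: Noetherian, and every localization at a maximal ideal is Gorenstein. -/
def IsGorensteinRing (A : Type u) [CommRing A] : Prop :=
  IsNoetherianRing A ∧
    ∀ (m : Ideal A) [m.IsMaximal], IsGorensteinLocalRing (Localization.AtPrime m)

/-- Every localization at an associated prime is Gorenstein. -/
def IsGenericallyGorenstein (A : Type u) [CommRing A] : Prop :=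
  ∀ (p : Ideal A) [p.IsPrime], p ∈ associatedPrimes A A →
    IsGorensteinLocalRing (Localization.AtPrime p)

/-- Maximal Cohen-Macaulay modules: finitely generated `M` with
`depth M_m ≥ dim A_m` for every maximal ideal `m` (the zero module is included). -/
def IsMCM (A : Type*) [CommRing A] (M : Type*) [AddCommGroup M] [Module A M] : Prop :=
  Module.Finite A M ∧
    ∀ (m : Ideal A) [m.IsMaximal],
      ringKrullDim (Localization.AtPrime m) ≤
        ((depth (Localization.AtPrime m) (LocalizedModule m.primeCompl M) : ℕ∞) : WithBot ℕ∞)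

/-- The `R`-module `M` belongs to `CM(S)`: its `R`-module structure is the restriction of
a maximal Cohen-Macaulay `S`-module structure. -/
def MemCM (R : Type*) [CommRing R] (S : Type*) [CommRing S] [Algebra R S]
    (M : Type*) [AddCommGroup M] [Module R M] : Prop :=
  ∃ _ : Module S M, IsScalarTower R S M ∧ IsMCM S M

/-- The `R`-module `M` belongs to `refl(R)`: it is finitely generated and reflexive. -/
def MemRefl (R : Type*) [CommRing R] (M : Type*) [AddCommGroup M] [Module R M] : Prop :=
  Module.Finite R M ∧ Module.IsReflexive R M

/-- The trace ideal of `M`: the sum of the images of all linear maps `M → R`. -/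
def traceIdeal (R : Type*) [CommRing R] (M : Type*) [AddCommGroup M] [Module R M] : Ideal R :=
  ⨆ f : M →ₗ[R] R, LinearMap.range f

/-- The conductor `(R :_Q S)`, viewed as an ideal of `R` (it lies in `R` because `1 ∈ S`). -/
def conductor {R : Type*} [CommRing R] {Q : Type*} [CommRing Q] [Algebra R Q]
    (S : Subalgebra R Q) : Ideal R :=
  ((1 : Submodule R Q) / Subalgebra.toSubmodule S).comap (Algebra.linearMap R Q)

/-- A stable ideal: an ideal that contains a non-zero-divisor and is isomorphic to its
endomorphism module. -/
def IsStable {R : Type*} [CommRing R] (I : Ideal R) : Prop :=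
  (∃ x ∈ I, x ∈ nonZeroDivisors R) ∧ Nonempty (I ≃ₗ[R] (I →ₗ[R] I))

end BirationalExt

/-!
Write `C = 1 / S` for the conductor, a fractional ideal of `S` isomorphic to `Hom_R(S, R)`. If `S`
is reflexive over `R`, then `S = 1 / C = C / C` is the endomorphism ring of `C`, so that
`S ≅ Hom_R(S, R)` says precisely that `C` is stable.

An isomorphism `S ≅ Hom_R(S, R)` sends `1` to a Frobenius form, composition with which identifies
`S`-duals with `R`-duals, so reflexivity over `S` and over `R` agree. Maximal Cohen-Macaulay modules
are reflexive over the one-dimensional Gorenstein ring `S` because `Ext¹(-, S)` vanishes on them.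

Conversely, if maximal Cohen-Macaulay `S`-modules are reflexive over `R`, then both `S / -` and
`C / -` are dualities on fractional ideals of `S`. Hence `C` is invertible, and it is isomorphic to
`S` because `S` is semilocal. Finally, a reflexive `R`-module `M` with trace in the conductor is an
`S`-module, because its image under the embedding `M → Hom_R(M*, Q)` is an `S`-submodule.
-/

namespace BirationalExt

open Module

open scoped nonZeroDivisors

section Ext

open CategoryTheory Abelian

variable {A : Type u} [CommRing A]

theorem exists_extension_of_subsingleton_ext {K F M B : Type u} [AddCommGroup K] [Module A K]
    [AddCommGroup F] [Module A F] [AddCommGroup M] [Module A M] [AddCommGroup B] [Module A B]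
    {i : K →ₗ[A] F} {p : F →ₗ[A] M} (hi : Function.Injective i) (hp : Function.Surjective p)
    (hip : Function.Exact i p)
    (h : Subsingleton (Ext (ModuleCat.of A M) (ModuleCat.of A B) 1)) (g : K →ₗ[A] B) :
    ∃ G : F →ₗ[A] B, G ∘ₗ i = g := by
  let T := ModuleCat.shortComplexOfCompEqZero i p hip.linearMap_comp_eq_zero
  have hT : T.ShortExact := ModuleCat.shortComplex_shortExact T hip hi hp
  obtain ⟨φ, hφ⟩ := Ext.contravariant_sequence_exact₁ hT (ModuleCat.of A B)
    (Ext.mk₀ (ModuleCat.ofHom g)) (add_zero 1) (Subsingleton.elim (α := Ext _ _ _) _ _)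
  obtain ⟨φ, rfl⟩ := Ext.homEquiv₀.symm.surjective φ
  have : T.f ≫ φ = ModuleCat.ofHom g := Ext.homEquiv₀.symm.injective (by simpa using hφ)
  exact ⟨φ.hom, congrArg ModuleCat.Hom.hom this⟩

theorem subsingleton_ext_of_exact {N₁ N₂ N₃ : Type u} [AddCommGroup N₁] [Module A N₁]
    [AddCommGroup N₂] [Module A N₂] [AddCommGroup N₃] [Module A N₃] {B : ModuleCat.{u} A}
    {f : N₁ →ₗ[A] N₂} {g : N₂ →ₗ[A] N₃} (hf : Function.Injective f) (hg : Function.Surjective g)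
    (hfg : Function.Exact f g) {r : ℕ} (h₁ : Subsingleton (Ext (ModuleCat.of A N₁) B r))
    (h₃ : Subsingleton (Ext (ModuleCat.of A N₃) B r)) :
    Subsingleton (Ext (ModuleCat.of A N₂) B r) := by
  let T := ModuleCat.shortComplexOfCompEqZero f g hfg.linearMap_comp_eq_zero
  have hT : T.ShortExact := ModuleCat.shortComplex_shortExact T hfg hf hg
  refine subsingleton_of_forall_eq 0 fun e => ?_
  obtain ⟨e', rfl⟩ := Ext.contravariant_sequence_exact₂ hT B e (h₁.elim _ _)
  rw [h₃.elim e' 0, Ext.comp_zero]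

theorem subsingleton_ext_of_injective {N₁ N₂ : Type u} [AddCommGroup N₁] [Module A N₁]
    [AddCommGroup N₂] [Module A N₂] {B : ModuleCat.{u} A}
    {f : N₁ →ₗ[A] N₂} (hf : Function.Injective f) {r : ℕ}
    (h₂ : Subsingleton (Ext (ModuleCat.of A N₂) B r))
    (h₃ : Subsingleton (Ext (ModuleCat.of A (N₂ ⧸ LinearMap.range f)) B (r + 1))) :
    Subsingleton (Ext (ModuleCat.of A N₁) B r) := by
  let T := ModuleCat.shortComplexOfCompEqZero f (LinearMap.range f).mkQ
    f.exact_map_mkQ_range.linearMap_comp_eq_zero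
  have hT : T.ShortExact := ModuleCat.shortComplex_shortExact T
    f.exact_map_mkQ_range hf (Submodule.mkQ_surjective _)
  refine subsingleton_of_forall_eq 0 fun e => ?_
  obtain ⟨e', rfl⟩ := Ext.contravariant_sequence_exact₁ hT B e (add_comm 1 r) (h₃.elim _ _)
  rw [h₂.elim e' 0, Ext.comp_zero]

theorem subsingleton_ext_of_projective (N : Type u) [AddCommGroup N] [Module A N]
    [Module.Projective A N] (B : ModuleCat.{u} A) (r : ℕ) :
    Subsingleton (Ext (ModuleCat.of A N) B (r + 1)) :=
  have : CategoryTheory.Projective (ModuleCat.of A N) :=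
    (IsProjective.iff_projective (R := A) N).mp inferInstance
  subsingleton_of_forall_eq 0 Ext.eq_zero_of_projective

theorem subsingleton_ext_of_linearEquiv {N₁ N₂ : Type u} [AddCommGroup N₁] [Module A N₁]
    [AddCommGroup N₂] [Module A N₂] {B : ModuleCat.{u} A} (e : N₁ ≃ₗ[A] N₂) {r : ℕ}
    (h : Subsingleton (Ext (ModuleCat.of A N₂) B r)) :
    Subsingleton (Ext (ModuleCat.of A N₁) B r) := by
  have : Subsingleton (((extFunctor r).obj (.op (ModuleCat.of A N₂))).obj B) := h
  exact (((extFunctor r).mapIso e.toModuleIso.op).app B).addCommGroupIsoToAddEquiv.symm.subsingleton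

theorem subsingleton_ext_quotSMulTop (B : ModuleCat.{u} A) {x : A} (hx : x ∈ A⁰) (r : ℕ) :
    Subsingleton (Ext (ModuleCat.of A (QuotSMulTop x A)) B (r + 2)) := by
  have hreg : IsSMulRegular (ModuleCat.of A A) x := (isRegular_iff_mem_nonZeroDivisors.mpr hx).left
  refine subsingleton_of_forall_eq 0 fun e => ?_
  obtain ⟨e', rfl⟩ := Ext.contravariant_sequence_exact₃ hreg.smulShortComplex_shortExact B
    (n₁ := r + 2) e ((subsingleton_ext_of_projective A B (r + 1)).elim _ _) (add_comm 1 (r + 1))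
  rw [(subsingleton_ext_of_projective A B r).elim e' 0]
  exact Ext.comp_zero _ _ _ _ _

/- Multiplication by `x` is surjective on `Ext^r(M, B)`, which is finitely generated, so
Nakayama's lemma applies. -/
theorem subsingleton_ext_of_isSMulRegular [IsNoetherianRing A] {M : Type u} [AddCommGroup M]
    [Module A M] [Module.Finite A M] (B : ModuleCat.{u} A) [Module.Finite A B] {x : A}
    (hxJ : x ∈ Ideal.jacobson (⊥ : Ideal A)) (hxM : IsSMulRegular M x) {r : ℕ}
    (h : Subsingleton (Ext (ModuleCat.of A (QuotSMulTop x M)) B (r + 1))) :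
    Subsingleton (Ext (ModuleCat.of A M) B r) := by
  have hreg : IsSMulRegular (ModuleCat.of A M) x := hxM
  have smul_eq_comp (e : Ext (ModuleCat.of A M) B r) :
      x • e = (Ext.mk₀ (x • 𝟙 (ModuleCat.of A M))).comp e (zero_add r) := by
    rw [Ext.mk₀_smul, Ext.smul_comp, Ext.mk₀_id_comp]
  have smul_surjective (e : Ext (ModuleCat.of A M) B r) : ∃ e', x • e' = e := by
    obtain ⟨e', he'⟩ := Ext.contravariant_sequence_exact₁ hreg.smulShortComplex_shortExact B e
      (add_comm 1 r) (h.elim _ _)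
    exact ⟨e', (smul_eq_comp e').trans he'⟩
  have htop : (⊤ : Submodule A (Ext (ModuleCat.of A M) B r)) = ⊥ := by
    refine Submodule.eq_bot_of_le_smul_of_le_jacobson_bot (Ideal.span {x}) _
      Module.Finite.fg_top (fun e _ => ?_) ((Ideal.span_singleton_le_iff_mem _).mpr hxJ)
    obtain ⟨e', rfl⟩ := smul_surjective e
    exact Submodule.smul_mem_smul (Ideal.mem_span_singleton_self x) Submodule.mem_top
  exact (Submodule.subsingleton_iff A).mp (subsingleton_of_bot_eq_top htop.symm)

end Ext

section DimensionOne

open CategoryTheory Abelian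

variable {A : Type u} [CommRing A] {x : A}

theorem isMaximal_of_mem_nonZeroDivisors [Ring.KrullDimLE 1 A] (hx : x ∈ A⁰) (p : Ideal A)
    [hp : p.IsPrime] (hxp : x ∈ p) : p.IsMaximal :=
  (Ring.krullDimLE_one_iff.mp inferInstance p hp).resolve_left fun hmin =>
    Set.disjoint_left.mp (Ideal.disjoint_nonZeroDivisors_of_mem_minimalPrimes hmin) hxp hx

theorem mem_minimalPrimes_span_singleton [Ring.KrullDimLE 1 A] (hx : x ∈ A⁰) (p : Ideal A)
    [hp : p.IsPrime] (hxp : x ∈ p) : p ∈ (Ideal.span {x}).minimalPrimes := by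
  refine ⟨⟨hp, (Ideal.span_singleton_le_iff_mem _).mpr hxp⟩, fun q ⟨hq, hxq⟩ hqp => ?_⟩
  have hqm := isMaximal_of_mem_nonZeroDivisors hx q ((Ideal.span_singleton_le_iff_mem _).mp hxq)
  exact (hqm.eq_of_le hp.ne_top hqp).ge

open scoped Pointwise in
theorem exists_injective_quotient_quotSMulTop [IsNoetherianRing A] [Ring.KrullDimLE 1 A]
    (hx : x ∈ A⁰) (p : Ideal A) [p.IsPrime] (hxp : x ∈ p) :
    ∃ f : (A ⧸ p) →ₗ[A] QuotSMulTop x A, Function.Injective f := by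
  have hann : annihilator A (QuotSMulTop x A) = Ideal.span {x} := by
    change annihilator A (A ⧸ x • (⊤ : Ideal A)) = _
    rw [← Submodule.ideal_span_singleton_smul, smul_eq_mul, Ideal.mul_top,
      Ideal.annihilator_quotient]
  have hp : p ∈ (annihilator A (QuotSMulTop x A)).minimalPrimes :=
    hann ▸ mem_minimalPrimes_span_singleton hx p hxp
  obtain ⟨-, h⟩ := (isAssociatedPrime_iff_exists_injective_linearMap _ _).mp
    (Module.associatedPrimes.minimalPrimes_annihilator_subset_associatedPrimes A _ hp)
  exact h

theorem isSMulRegular_quotient_of_notMem (p : Ideal A) [hp : p.IsPrime] (hxp : x ∉ p) :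
    IsSMulRegular (A ⧸ p) x :=
  isSMulRegular_quotient_iff_mem_of_smul_mem .. |>.mpr fun _ ha =>
    (hp.mem_or_mem ha).resolve_left hxp

variable [IsNoetherianRing A] [Ring.KrullDimLE 1 A]

theorem subsingleton_ext_of_subsingleton_ext_succ (hx : x ∈ A⁰)
    (hxJ : x ∈ Ideal.jacobson (⊥ : Ideal A)) (B : ModuleCat.{u} A) [Module.Finite A B] {r : ℕ}
    (h : ∀ (N : Type u) [AddCommGroup N] [Module A N] [Module.Finite A N],
      Subsingleton (Ext (ModuleCat.of A N) B (r + 3)))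
    (N : Type u) [AddCommGroup N] [Module A N] [hN : Module.Finite A N] :
    Subsingleton (Ext (ModuleCat.of A N) B (r + 2)) := by
  induction hN using IsNoetherianRing.induction_on_isQuotientEquivQuotientPrime A with
  | subsingleton N =>
    exact subsingleton_ext_of_projective N B (r + 1)
  | quotient N p e =>
    have := p.2
    refine subsingleton_ext_of_linearEquiv e ?_
    by_cases hxp : x ∈ p.1
    · obtain ⟨f, hf⟩ := exists_injective_quotient_quotSMulTop hx p.1 hxp
      exact subsingleton_ext_of_injective hf (subsingleton_ext_quotSMulTop B hx r) (h _)
    · exact subsingleton_ext_of_isSMulRegular B hxJ (isSMulRegular_quotient_of_notMem p.1 hxp) (h _)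
  | exact N₁ N₂ N₃ f g hf hg hfg h₁ h₃ => exact subsingleton_ext_of_exact hf hg hfg h₁ h₃

theorem subsingleton_ext_add_two (hx : x ∈ A⁰) (hxJ : x ∈ Ideal.jacobson (⊥ : Ideal A))
    (B : ModuleCat.{u} A) [Module.Finite A B] {n : ℕ} (hB : HasInjectiveDimensionLE B n) (r : ℕ)
    (N : Type u) [AddCommGroup N] [Module A N] [Module.Finite A N] :
    Subsingleton (Ext (ModuleCat.of A N) B (r + 2)) := by
  by_cases hr : n ≤ r
  · exact HasInjectiveDimensionLT.subsingleton B (n + 1) _ (by lia) _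
  · exact subsingleton_ext_of_subsingleton_ext_succ hx hxJ B
      (fun N _ _ _ => subsingleton_ext_add_two hx hxJ B hB (r + 1) N) N
termination_by n - r

theorem subsingleton_ext_one (hx : x ∈ A⁰) (hxJ : x ∈ Ideal.jacobson (⊥ : Ideal A))
    (B : ModuleCat.{u} A) [Module.Finite A B] {n : ℕ} (hB : HasInjectiveDimensionLE B n)
    (M : Type u) [AddCommGroup M] [Module A M] [Module.Finite A M] (hM : IsSMulRegular M x) :
    Subsingleton (Ext (ModuleCat.of A M) B 1) :=
  subsingleton_ext_of_isSMulRegular B hxJ hM (subsingleton_ext_add_two hx hxJ B hB 0 _)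

end DimensionOne

section Reflexive

open CategoryTheory Abelian

variable {A : Type u} [CommRing A] {K F M : Type u} [AddCommGroup K] [Module A K]
  [AddCommGroup F] [Module A F] [AddCommGroup M] [Module A M] {i : K →ₗ[A] F} {p : F →ₗ[A] M}

theorem surjective_dualMap_of_subsingleton_ext (hi : Function.Injective i)
    (hp : Function.Surjective p) (hip : Function.Exact i p)
    (h : Subsingleton (Ext (ModuleCat.of A M) (ModuleCat.of A A) 1)) :
    Function.Surjective i.dualMap :=
  exists_extension_of_subsingleton_ext hi hp hip h

theorem surjective_dual_eval (hi : Function.Injective i) (hp : Function.Surjective p)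
    (hip : Function.Exact i p) [IsReflexive A F]
    (hM : Subsingleton (Ext (ModuleCat.of A M) (ModuleCat.of A A) 1))
    (hK : Subsingleton (Ext (ModuleCat.of A (Dual A K)) (ModuleCat.of A A) 1)) :
    Function.Surjective (Dual.eval A M) := by
  have hp'' : Function.Surjective p.dualMap.dualMap :=
    surjective_dualMap_of_subsingleton_ext (p.dualMap_injective_of_surjective hp)
      (surjective_dualMap_of_subsingleton_ext hi hp hip hM)
      (LinearMap.exact_lcomp_of_exact_of_surjective A hip hp) hK
  refine Function.Surjective.of_comp (g := p) ?_
  exact hp''.comp (bijective_dual_eval A F).surjective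

theorem injective_dual_eval (hi : Function.Injective i) (hp : Function.Surjective p)
    (hip : Function.Exact i p) [IsReflexive A F]
    (hM : Subsingleton (Ext (ModuleCat.of A M) (ModuleCat.of A A) 1))
    (hK : Function.Surjective (Dual.eval A K)) : Function.Injective (Dual.eval A M) := by
  have hexact : Function.Exact i.dualMap.dualMap p.dualMap.dualMap :=
    LinearMap.exact_lcomp_of_exact_of_surjective A
      (LinearMap.exact_lcomp_of_exact_of_surjective A hip hp)
      (surjective_dualMap_of_subsingleton_ext hi hp hip hM)
  refine (injective_iff_map_eq_zero _).mpr fun m hm => ?_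
  obtain ⟨a, rfl⟩ := hp m
  obtain ⟨Φ, hΦ⟩ := (hexact (Dual.eval A F a)).mp hm
  obtain ⟨b, rfl⟩ := hK Φ
  exact (hip a).mpr ⟨b, (bijective_dual_eval A F).injective hΦ⟩

theorem isReflexive_of_isSMulRegular {A : Type u} [CommRing A] [IsNoetherianRing A] {x : A}
    (hx : IsSMulRegular A x)
    (hext : ∀ (N : Type u) [AddCommGroup N] [Module A N] [Module.Finite A N],
      IsSMulRegular N x → Subsingleton (Ext (ModuleCat.of A N) (ModuleCat.of A A) 1))
    (M : Type u) [AddCommGroup M] [Module A M] [Module.Finite A M] (hM : IsSMulRegular M x) :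
    IsReflexive A M := by
  have hdual (N : Type u) [AddCommGroup N] [Module A N] : IsSMulRegular (Dual A N) x :=
    fun f g hfg => LinearMap.ext fun m => hx (LinearMap.congr_fun hfg m)
  have hsurj (N : Type u) [AddCommGroup N] [Module A N] [Module.Finite A N]
      (hN : IsSMulRegular N x) : Function.Surjective (Dual.eval A N) := by
    obtain ⟨k, p, hp⟩ := Module.Finite.exists_fin' A N
    exact surjective_dual_eval (Submodule.injective_subtype _) hp
      (LinearMap.exact_subtype_ker_map p) (hext N hN) (hext _ (hdual _))
  obtain ⟨k, p, hp⟩ := Module.Finite.exists_fin' A M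
  have hker : IsSMulRegular (LinearMap.ker p) x :=
    (IsSMulRegular.pi fun _ => hx).submodule _ _
  exact ⟨injective_dual_eval (Submodule.injective_subtype _) hp
    (LinearMap.exact_subtype_ker_map p) (hext M hM) (hsurj _ hker), hsurj M hM⟩

end Reflexive

section Semilocal

open CategoryTheory

variable {A : Type u} [CommRing A] {x : A}

theorem mem_of_mem_jacobson_bot (hxJ : x ∈ Ideal.jacobson (⊥ : Ideal A)) (m : Ideal A)
    [hm : m.IsMaximal] : x ∈ m :=
  Ideal.mem_sInf.mp hxJ ⟨bot_le, hm⟩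

theorem finite_maximalSpectrum [IsNoetherianRing A] [Ring.KrullDimLE 1 A] (hx : x ∈ A⁰)
    (hxJ : x ∈ Ideal.jacobson (⊥ : Ideal A)) : Finite (MaximalSpectrum A) := by
  have := (Ideal.finite_minimalPrimes_of_isNoetherianRing A (Ideal.span {x})).to_subtype
  let toMinimalPrimes (m : MaximalSpectrum A) : (Ideal.span {x}).minimalPrimes :=
    ⟨m.1, mem_minimalPrimes_span_singleton hx m.1 (mem_of_mem_jacobson_bot hxJ m.1)⟩
  exact Finite.of_injective toMinimalPrimes fun a b hab =>
    MaximalSpectrum.ext (congrArg Subtype.val hab)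

theorem IsGorensteinRing.exists_hasInjectiveDimensionLE (hA : IsGorensteinRing A)
    [Finite (MaximalSpectrum A)] : ∃ n : ℕ, HasInjectiveDimensionLE (ModuleCat.of A A) n := by
  have := hA.1
  have h (m : MaximalSpectrum A) : ∃ n : ℕ, HasInjectiveDimensionLE
      ((ModuleCat.of A A).localizedModule m.1.primeCompl) n := by
    obtain ⟨-, n, hn⟩ := hA.2 m.1
    have := ModuleCat.localizedModule_isLocalizedModule (ModuleCat.of A A) m.1.primeCompl
    refine ⟨n, (ModuleCat.hasInjectiveDimensionLE_iff_of_linearEquiv ?_ n).mp hn⟩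
    exact LinearEquiv.extendScalarsOfIsLocalization m.1.primeCompl (Localization.AtPrime m.1)
      (IsLocalizedModule.linearEquiv m.1.primeCompl
        (Algebra.linearMap A (Localization.AtPrime m.1))
        ((ModuleCat.of A A).localizedModuleMkLinearMap m.1.primeCompl))
  choose n hn using h
  obtain ⟨N, hN⟩ := (Set.finite_range n).bddAbove
  refine ⟨N, (ModuleCat.hasInjectiveDimensionLE_iff_forall_maximalSpectrum N _).mpr fun m => ?_⟩
  have := hn m
  exact hasInjectiveDimensionLT_of_ge _ (n m + 1) (N + 1)
    (Nat.succ_le_succ (hN (Set.mem_range_self m)))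

theorem IsGorensteinRing.isReflexive_of_isSMulRegular (hA : IsGorensteinRing A)
    [Ring.KrullDimLE 1 A] (hx : x ∈ A⁰) (hxJ : x ∈ Ideal.jacobson (⊥ : Ideal A))
    (M : Type u) [AddCommGroup M] [Module A M] [Module.Finite A M] (hM : IsSMulRegular M x) :
    IsReflexive A M := by
  have := hA.1
  have := finite_maximalSpectrum hx hxJ
  obtain ⟨n, hn⟩ := hA.exists_hasInjectiveDimensionLE
  exact BirationalExt.isReflexive_of_isSMulRegular (isRegular_iff_mem_nonZeroDivisors.mpr hx).left
    (fun N _ _ _ hN => subsingleton_ext_one hx hxJ _ hn N hN) M hM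

end Semilocal

section Depth

theorem one_le_depth_iff {A : Type*} [CommRing A] [IsLocalRing A] {M : Type*} [AddCommGroup M]
    [Module A M] :
    1 ≤ depth A M ↔ ∃ y ∈ IsLocalRing.maximalIdeal A, IsSMulRegular M y := by
  rw [Order.one_le_iff_pos, depth]
  simp only [lt_iSup_iff]
  constructor
  · rintro ⟨rs, hrs, hreg, hpos⟩
    obtain ⟨y, ys, rfl⟩ := List.exists_cons_of_length_pos (Nat.cast_pos.mp hpos)
    exact ⟨y, hrs y List.mem_cons_self,
      ((RingTheory.Sequence.isWeaklyRegular_cons_iff M y ys).mp hreg).1⟩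
  · rintro ⟨y, hy, hreg⟩
    exact ⟨[y], by simpa using hy, (RingTheory.Sequence.isWeaklyRegular_cons_iff M y []).mpr
      ⟨hreg, RingTheory.Sequence.IsWeaklyRegular.nil _ _⟩, by simp⟩

variable {A : Type*} [CommRing A] {x : A} {M : Type*} [AddCommGroup M] [Module A M]

theorem notMem_associatedPrimes_of_isSMulRegular [IsNoetherianRing A] {p : Ideal A} [p.IsPrime]
    {y : Localization.AtPrime p} (hy : y ∈ IsLocalRing.maximalIdeal (Localization.AtPrime p))
    (hreg : IsSMulRegular (LocalizedModule p.primeCompl M) y) : p ∉ associatedPrimes A M := by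
  intro hp
  have hmem : IsLocalRing.maximalIdeal (Localization.AtPrime p) ∈
      associatedPrimes (Localization.AtPrime p) (LocalizedModule p.primeCompl M) :=
    Module.associatedPrimes.mem_associatedPrimes_atPrime_of_mem_associatedPrimes hp
  have := Set.mem_biUnion hmem hy
  rw [biUnion_associatedPrimes_eq_compl_regular] at this
  exact this hreg

variable [IsNoetherianRing A] [Ring.KrullDimLE 1 A]

theorem ringKrullDim_localization_eq_one (hx : x ∈ A⁰) (p : Ideal A) [p.IsPrime] (hxp : x ∈ p) :
    ringKrullDim (Localization.AtPrime p) = 1 := by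
  have hle : p.height ≤ 1 := Ideal.height_le_one_of_isPrincipal_of_mem_minimalPrimes _ _
    (mem_minimalPrimes_span_singleton hx p hxp)
  have hne : p.height ≠ 0 := fun h0 => Set.disjoint_left.mp
    (Ideal.disjoint_nonZeroDivisors_of_mem_minimalPrimes (Ideal.height_eq_zero_iff.mp h0)) hxp hx
  rw [IsLocalization.AtPrime.ringKrullDim_eq_height p,
    le_antisymm hle (Order.one_le_iff_ne_zero.mpr hne), WithBot.coe_one]

theorem ringKrullDim_le_depth_iff (hx : x ∈ A⁰) (p : Ideal A) [p.IsPrime] (hxp : x ∈ p) :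
    ringKrullDim (Localization.AtPrime p) ≤
        ((depth (Localization.AtPrime p) (LocalizedModule p.primeCompl M) : ℕ∞) : WithBot ℕ∞) ↔
      ∃ y ∈ IsLocalRing.maximalIdeal (Localization.AtPrime p),
        IsSMulRegular (LocalizedModule p.primeCompl M) y := by
  rw [ringKrullDim_localization_eq_one hx p hxp, ← one_le_depth_iff]
  norm_cast

theorem isMCM_iff_isSMulRegular (hx : x ∈ A⁰) (hxJ : x ∈ Ideal.jacobson (⊥ : Ideal A)) :
    IsMCM A M ↔ Module.Finite A M ∧ IsSMulRegular M x := by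
  refine and_congr_right fun _ => ⟨fun h => ?_, fun h m hm => ?_⟩
  · by_contra hxM
    have hx' : x ∈ ⋃ p ∈ associatedPrimes A M, (p : Set A) := by
      rwa [biUnion_associatedPrimes_eq_compl_regular]
    obtain ⟨p, hp, hxp⟩ := Set.mem_iUnion₂.mp hx'
    have := hp.isPrime
    have := isMaximal_of_mem_nonZeroDivisors hx p hxp
    obtain ⟨y, hy, hreg⟩ := (ringKrullDim_le_depth_iff hx p hxp).mp (h p)
    exact notMem_associatedPrimes_of_isSMulRegular hy hreg hp
  · have hxm := mem_of_mem_jacobson_bot hxJ m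
    exact (ringKrullDim_le_depth_iff hx m hxm).mpr
      ⟨algebraMap A _ x, (IsLocalization.AtPrime.to_map_mem_maximal_iff _ m x).mpr hxm,
        h.of_isLocalizedModule _ m.primeCompl (LocalizedModule.mkLinearMap m.primeCompl M)⟩

end Depth

section Integral

variable {A B : Type*} [CommRing A] [CommRing B] [Algebra A B] [Algebra.IsIntegral A B]

theorem krullDimLE_of_isIntegral (n : ℕ) [Ring.KrullDimLE n A] : Ring.KrullDimLE n B := by
  have hmono : StrictMono (PrimeSpectrum.comap (algebraMap A B)) := fun _ _ hpq =>
    Ideal.IsIntegral.comap_lt_comap hpq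
  exact (Order.krullDimLE_iff _ _).mpr <|
    (Order.krullDim_le_of_strictMono _ hmono).trans ((Order.krullDimLE_iff _ _).mp ‹_›)

theorem algebraMap_mem_jacobson_bot {x : A} (hx : x ∈ Ideal.jacobson (⊥ : Ideal A)) :
    algebraMap A B x ∈ Ideal.jacobson (⊥ : Ideal B) := by
  refine Ideal.mem_sInf.mpr fun {m} hm => ?_
  have := hm.2
  have := Ideal.isMaximal_comap_of_isIntegral_of_isMaximal (R := A) m
  exact mem_of_mem_jacobson_bot hx (m.comap (algebraMap A B))

theorem algebraMap_mem_nonZeroDivisors {R S : Type*} [CommRing R] [CommRing S] [Algebra R S]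
    [IsTorsionFree R S] {x : R} (hx : x ∈ R⁰) : algebraMap R S x ∈ S⁰ := by
  have : IsSMulRegular S (algebraMap R S x) := (isSMulRegular_algebraMap_iff S).mpr
    (IsTorsionFree.isSMulRegular (isRegular_iff_mem_nonZeroDivisors.mpr hx))
  exact isRegular_iff_mem_nonZeroDivisors.mp (isLeftRegular_iff_isRegular.mp this)

end Integral

section TorsionFree

variable {R : Type*} [CommRing R] [Ring.KrullDimLE 1 R] {x : R}

theorem isMCM_iff_isTorsionFree (hx : x ∈ R⁰) (hxJ : x ∈ Ideal.jacobson (⊥ : Ideal R))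
    {S : Type*} [CommRing S] [Algebra R S] [Algebra.IsIntegral R S] [IsTorsionFree R S]
    [IsNoetherianRing S] {M : Type*} [AddCommGroup M] [Module R M] [Module S M]
    [IsScalarTower R S M] :
    IsMCM S M ↔ Module.Finite S M ∧ IsTorsionFree R M := by
  have := krullDimLE_of_isIntegral (A := R) (B := S) 1
  have isMCM_iff (y : R) (hy : y ∈ R⁰) (hyJ : y ∈ Ideal.jacobson (⊥ : Ideal R)) :
      IsMCM S M ↔ Module.Finite S M ∧ IsSMulRegular M y := by
    rw [isMCM_iff_isSMulRegular (algebraMap_mem_nonZeroDivisors hy)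
      (algebraMap_mem_jacobson_bot hyJ), isSMulRegular_algebraMap_iff]
  refine ⟨fun h => ⟨h.1, ⟨fun y hy => ?_⟩⟩, fun h => (isMCM_iff x hx hxJ).mpr ⟨h.1, ?_⟩⟩
  · have hxy : IsSMulRegular M (x * y) :=
      ((isMCM_iff (x * y) (mul_mem hx hy.mem_nonZeroDivisors) (Ideal.mul_mem_right y _ hxJ)).mp h).2
    exact hxy.of_mul
  · exact h.2.isSMulRegular (isRegular_iff_mem_nonZeroDivisors.mpr hx)

theorem memCM_of_isTorsionFree (hx : x ∈ R⁰) (hxJ : x ∈ Ideal.jacobson (⊥ : Ideal R))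
    {S : Type*} [CommRing S] [Algebra R S] [Algebra.IsIntegral R S] [IsTorsionFree R S]
    [IsNoetherianRing S] (M : Type*) [AddCommGroup M] [Module R M] [Module S M]
    [IsScalarTower R S M] [Module.Finite S M] [IsTorsionFree R M] : MemCM R S M :=
  ⟨inferInstance, inferInstance,
    (isMCM_iff_isTorsionFree hx hxJ).mpr ⟨inferInstance, inferInstance⟩⟩

theorem IsGorensteinRing.isReflexive_of_isTorsionFree (hx : x ∈ R⁰)
    (hxJ : x ∈ Ideal.jacobson (⊥ : Ideal R)) {S : Type u} [CommRing S] [Algebra R S]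
    [Algebra.IsIntegral R S] [IsTorsionFree R S] (hS : IsGorensteinRing S) (M : Type u)
    [AddCommGroup M] [Module R M] [Module S M] [IsScalarTower R S M] [Module.Finite S M]
    [IsTorsionFree R M] : IsReflexive S M := by
  have := krullDimLE_of_isIntegral (A := R) (B := S) 1
  refine hS.isReflexive_of_isSMulRegular (algebraMap_mem_nonZeroDivisors hx)
    (algebraMap_mem_jacobson_bot hxJ) M ((isSMulRegular_algebraMap_iff S).mpr ?_)
  exact IsTorsionFree.isSMulRegular (isRegular_iff_mem_nonZeroDivisors.mpr hx)

end TorsionFree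

section Fractional

variable {A Q : Type*} [CommRing A] [CommRing Q] [Algebra A Q]

theorem div_mul_eq_div_div (I J K : Submodule A Q) : I / (J * K) = I / J / K :=
  eq_of_forall_le_iff fun L => by
    rw [Submodule.le_div_iff_mul_le, Submodule.le_div_iff_mul_le, Submodule.le_div_iff_mul_le,
      mul_comm J K, mul_assoc]

theorem div_one_eq_self (I : Submodule A Q) : I / 1 = I :=
  eq_of_forall_le_iff fun L => by rw [Submodule.le_div_iff_mul_le, mul_one]

/- The duality `C / -` sends `C * (1 / C)` to `(C / C) / (1 / C) = 1 / (1 / C) = C`, which is also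
the dual of `1`. -/
theorem mul_one_div_eq_one {C : Submodule A Q} (hone : C / (C / 1) = 1) (hC : 1 / (1 / C) = C)
    (hmul : C / (C / (C * (1 / C))) = C * (1 / C)) : C * (1 / C) = 1 := by
  rw [div_one_eq_self] at hone
  rw [← hmul, div_mul_eq_div_div, hone, hC, hone]

theorem fg_of_le_one [IsNoetherianRing A] {I : Submodule A Q} (hI : I ≤ 1) : I.FG := by
  rw [Submodule.one_eq_range] at hI
  rw [← Submodule.map_comap_eq_self hI]
  exact (IsNoetherian.noetherian _).map _

theorem nonempty_linearEquiv_of_mul_eq_one [FaithfulSMul A Q] [Finite (MaximalSpectrum A)]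
    {I J : Submodule A Q} (hIJ : I * J = 1) : Nonempty (I ≃ₗ[A] A) := by
  let I' : (Submodule A Q)ˣ := Units.mkOfMulEqOne I J hIJ
  change Nonempty (I' ≃ₗ[A] A)
  exact Module.Invertible.free_iff_linearEquiv.mp inferInstance

/-- The map `J / I → Hom(I, J)` sending `q` to multiplication by `q`. -/
def divToHom (I J : Submodule A Q) : ↥(J / I) →ₗ[A] (I →ₗ[A] J) :=
  LinearMap.mk₂ A (fun q i => ⟨q * i, Submodule.mem_div_iff_forall_mul_mem.mp q.2 i i.2⟩)
    (fun _ _ _ => Subtype.ext (add_mul _ _ _)) (fun _ _ _ => Subtype.ext (smul_mul_assoc _ _ _))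
    (fun _ _ _ => Subtype.ext (mul_add _ _ _)) (fun _ _ _ => Subtype.ext (mul_smul_comm _ _ _))

variable [IsFractionRing A Q]

theorem apply_mul_eq_mul_apply {I J : Submodule A Q} (f : I →ₗ[A] J) (i j : I) :
    (f i * j : Q) = i * f j := by
  obtain ⟨⟨a, b⟩, hab⟩ := IsLocalization.surj A⁰ (i : Q)
  obtain ⟨⟨c, d⟩, hcd⟩ := IsLocalization.surj A⁰ (j : Q)
  have hsmul : (d : A) • a • j = (b : A) • c • i := by
    ext
    simp only [Submodule.coe_smul, Algebra.smul_def, ← hab, ← hcd]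
    ring
  have hf := congrArg (fun k => (f k : Q)) hsmul
  simp only [map_smul, Submodule.coe_smul, Algebra.smul_def, ← hab, ← hcd] at hf
  refine ((IsLocalization.map_units Q b).mul (IsLocalization.map_units Q d)).mul_left_cancel ?_
  linear_combination -hf

theorem bijective_divToHom {I : Submodule A Q} (J : Submodule A Q) {u : Q} (hu : u ∈ I)
    (hu' : IsUnit u) : Function.Bijective (divToHom I J) := by
  obtain ⟨v, hv⟩ := hu'.exists_left_inv
  refine ⟨fun q r hqr => Subtype.ext (hu'.mul_right_cancel ?_), fun f => ?_⟩
  · exact congrArg Subtype.val (LinearMap.congr_fun hqr ⟨u, hu⟩)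
  · have hf (i : I) : f ⟨u, hu⟩ * v * i = f i := by
      linear_combination v * apply_mul_eq_mul_apply f ⟨u, hu⟩ i + f i * hv
    refine ⟨⟨f ⟨u, hu⟩ * v, Submodule.mem_div_iff_forall_mul_mem.mpr fun i hi => ?_⟩, ?_⟩
    · exact hf ⟨i, hi⟩ ▸ (f ⟨i, hi⟩).2
    · exact LinearMap.ext fun i => Subtype.ext (hf i)

/-- The isomorphism between `1 / I` and the dual of `I`. -/
noncomputable def oneDivEquivDual (I : Submodule A Q) {u : Q} (hu : u ∈ I) (hu' : IsUnit u) :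
    ↥(1 / I) ≃ₗ[A] Dual A I :=
  (LinearEquiv.ofBijective (divToHom I 1) (bijective_divToHom 1 hu hu')).trans
    (LinearEquiv.congrRight (M := I) ((LinearEquiv.ofEq _ _ Submodule.one_eq_range).trans
      (LinearEquiv.ofInjective (Algebra.linearMap A Q) (IsFractionRing.injective A Q)).symm))

theorem algebraMap_oneDivEquivDual_apply {I : Submodule A Q} {u : Q} (hu : u ∈ I) (hu' : IsUnit u)
    (q : ↥(1 / I)) (i : I) : algebraMap A Q (oneDivEquivDual I hu hu' q i) = q * i :=
  congrArg Subtype.val ((LinearEquiv.ofInjective (Algebra.linearMap A Q)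
    (IsFractionRing.injective A Q)).apply_symm_apply _)

theorem exists_algebraMap_mem_one_div {I : Submodule A Q} (hI : I.FG) :
    ∃ d ∈ A⁰, algebraMap A Q d ∈ 1 / I := by
  obtain ⟨d, hd, h⟩ := FractionalIdeal.isFractional_of_fg (S := A⁰) hI
  refine ⟨d, hd, Submodule.mem_div_iff_forall_mul_mem.mpr fun i hi => ?_⟩
  rw [← Algebra.smul_def]
  exact Submodule.mem_one.mpr (h i hi)

theorem one_div_one_div_eq_self (I : Submodule A Q) [IsReflexive A I] (hI : I.FG) {u : Q}
    (hu : u ∈ I) (hu' : IsUnit u) : 1 / (1 / I) = I := by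
  refine le_antisymm (fun q hq => ?_) (Submodule.le_div_iff_mul_le.mpr Submodule.mul_one_div_le_one)
  obtain ⟨d, hd, hdI⟩ := exists_algebraMap_mem_one_div hI
  have hd' : IsUnit (algebraMap A Q d) := IsLocalization.map_units Q ⟨d, hd⟩
  let toDual := oneDivEquivDual I hu hu'
  let Φ : Dual A (Dual A I) := oneDivEquivDual (1 / I) hdI hd' ⟨q, hq⟩ ∘ₗ toDual.symm.toLinearMap
  obtain ⟨i, hi⟩ := (bijective_dual_eval A I).2 Φ
  have hqd : algebraMap A Q d * i = q * algebraMap A Q d :=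
    calc algebraMap A Q d * i = algebraMap A Q (toDual ⟨_, hdI⟩ i) :=
          (algebraMap_oneDivEquivDual_apply hu hu' ⟨_, hdI⟩ i).symm
      _ = algebraMap A Q (Φ (toDual ⟨_, hdI⟩)) := by rw [← hi, Dual.eval_apply]
      _ = q * algebraMap A Q d := by
          rw [LinearMap.comp_apply, LinearEquiv.coe_coe, toDual.symm_apply_apply,
            algebraMap_oneDivEquivDual_apply]
  rw [mul_comm q] at hqd
  exact hd'.mul_left_cancel hqd ▸ i.2

end Fractional

section Frobenius

variable {R S : Type*} [CommRing R] [CommRing S] [Algebra R S]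

/-- A linear form `τ` on an `R`-algebra `S` is a Frobenius form if `s ↦ τ (s * ·)` is a bijection
from `S` onto its `R`-dual. -/
def IsFrobeniusForm (τ : S →ₗ[R] R) : Prop :=
  Function.Bijective fun s : S => τ ∘ₗ LinearMap.mulLeft R s

variable (τ : S →ₗ[R] R) (M : Type*) [AddCommGroup M] [Module R M] [Module S M]
  [IsScalarTower R S M]

/-- Composition with a linear form `τ` on `S`, as a map from the `S`-dual to the `R`-dual. -/
def dualComp : Dual S M →ₗ[R] Dual R M where
  toFun f := τ ∘ₗ f.restrictScalars R
  map_add' _ _ := LinearMap.ext fun _ => map_add τ _ _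
  map_smul' _ _ := LinearMap.ext fun _ => map_smul τ _ _

variable {τ}

theorem IsFrobeniusForm.bijective_dualComp (hτ : IsFrobeniusForm τ) :
    Function.Bijective (dualComp τ M) := by
  refine ⟨fun f g hfg => LinearMap.ext fun m => hτ.1 (LinearMap.ext fun t => ?_), fun h => ?_⟩
  · have htm : τ (f (t • m)) = τ (g (t • m)) := LinearMap.congr_fun hfg (t • m)
    rwa [f.map_smul, g.map_smul, smul_eq_mul, smul_eq_mul, mul_comm t, mul_comm t] at htm
  · choose σ hσ using fun m => hτ.2 (h ∘ₗ (LinearMap.toSpanSingleton S M m).restrictScalars R)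
    have τ_σ (m : M) (t : S) : τ (σ m * t) = h (t • m) := LinearMap.congr_fun (hσ m) t
    have eq_σ {a : S} {m : M} (ha : ∀ t, τ (a * t) = h (t • m)) : a = σ m :=
      hτ.1 (LinearMap.ext fun t => (ha t).trans (τ_σ m t).symm)
    let f : Dual S M :=
      { toFun := σ
        map_add' := fun m n => (eq_σ fun t => by
          rw [add_mul, map_add, τ_σ, τ_σ, smul_add, map_add]).symm
        map_smul' := fun s m => (eq_σ fun t => by
          rw [RingHom.id_apply, smul_eq_mul, mul_comm s, mul_assoc, τ_σ, mul_comm, mul_smul]).symm }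
    refine ⟨f, LinearMap.ext fun m => ?_⟩
    change τ (σ m) = h m
    rw [← mul_one (σ m), τ_σ, one_smul]

theorem IsFrobeniusForm.isReflexive (hτ : IsFrobeniusForm τ) [IsReflexive S M] :
    IsReflexive R M := by
  let dualCompEquiv := LinearEquiv.ofBijective (dualComp τ M) (hτ.bijective_dualComp M)
  have hsquare : dualCompEquiv.dualMap ∘ Dual.eval R M =
      dualComp τ (Dual S M) ∘ Dual.eval S M := rfl
  refine ⟨(Function.Bijective.of_comp_iff' dualCompEquiv.dualMap.bijective _).mp ?_⟩
  exact hsquare ▸ (hτ.bijective_dualComp _).comp (bijective_dual_eval S M)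

end Frobenius

theorem exists_module_of_injective {R S M N : Type*} [CommRing R] [CommRing S] [Algebra R S]
    [AddCommGroup M] [Module R M] [AddCommGroup N] [Module R N] [Module S N] [IsScalarTower R S N]
    (ι : M →ₗ[R] N) (hι : Function.Injective ι) (h : ∀ (s : S) m, s • ι m ∈ LinearMap.range ι) :
    ∃ _ : Module S M, IsScalarTower R S M := by
  choose smul hsmul using h
  let : SMul S M := ⟨smul⟩
  refine ⟨hι.module S ι.toAddMonoidHom hsmul, ⟨fun r s m => hι ?_⟩⟩
  calc ι (smul (r • s) m) = r • s • ι m := by rw [hsmul, smul_assoc]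
    _ = ι (r • smul s m) := by rw [map_smul, hsmul]

section Birational

variable {R Q : Type*} [CommRing R] [CommRing Q] [Algebra R Q]

/-- The conductor `1 / S` of a subalgebra `S`, as an `S`-submodule of the ambient algebra. -/
def conductorSubmodule (S : Subalgebra R Q) : Submodule S Q where
  __ := (1 : Submodule R Q) / Subalgebra.toSubmodule S
  smul_mem' s q hq := Submodule.mem_div_iff_forall_mul_mem.mpr fun t ht => by
    rw [Algebra.smul_def, mul_comm, ← mul_assoc, mul_comm]
    exact Submodule.mem_div_iff_forall_mul_mem.mp hq _ (S.mul_mem ht s.2)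

theorem one_div_restrictScalars (S : Subalgebra R Q) (I : Submodule S Q) :
    1 / I.restrictScalars R = (conductorSubmodule S / I).restrictScalars R := by
  ext q
  simp only [Submodule.mem_div_iff_forall_mul_mem, Submodule.restrictScalars_mem]
  refine ⟨fun h i hi => Submodule.mem_div_iff_forall_mul_mem.mpr fun s hs => ?_, fun h i hi => ?_⟩
  · rw [mul_assoc, mul_comm i]
    exact h _ (I.smul_mem ⟨s, hs⟩ hi)
  · rw [← mul_one (q * i)]
    exact Submodule.mem_div_iff_forall_mul_mem.mp (h i hi) 1 S.one_mem

theorem mem_conductor {S : Subalgebra R Q} {r : R} :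
    r ∈ conductor S ↔ ∀ s ∈ S, algebraMap R Q r * s ∈ (1 : Submodule R Q) :=
  Submodule.mem_div_iff_forall_mul_mem

theorem one_div_le_one {I : Submodule R Q} (hI : 1 ∈ I) : 1 / I ≤ 1 := fun q hq => by
  rw [← mul_one q]
  exact Submodule.mem_div_iff_forall_mul_mem.mp hq 1 hI

variable [IsFractionRing R Q]

instance isTorsionFree_isFractionRing : IsTorsionFree R Q where
  isSMulRegular r hr := (isSMulRegular_algebraMap_iff Q).mp
    ((IsLocalization.map_units Q ⟨r, hr.mem_nonZeroDivisors⟩).isSMulRegular Q)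

variable (S : Subalgebra R Q)

instance isTorsionFree_submodule (I : Submodule S Q) : IsTorsionFree R I :=
  I.subtype_injective.moduleIsTorsionFree _ fun _ _ => rfl

instance isFractionRing_subalgebra : IsFractionRing S Q where
  map_units s := by
    obtain ⟨⟨a, b⟩, hab⟩ := IsLocalization.surj R⁰ (s : Q)
    have hab' : (s : S) * algebraMap R S b = algebraMap R S a := Subtype.ext hab
    have ha : a ∈ R⁰ := by
      refine mem_nonZeroDivisors_of_injective (f := algebraMap R S)
        (fun _ _ h => IsFractionRing.injective R Q (congrArg Subtype.val h)) ?_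
      exact hab' ▸ mul_mem s.2 (algebraMap_mem_nonZeroDivisors b.2)
    exact isUnit_of_mul_isUnit_left (hab ▸ IsLocalization.map_units Q ⟨a, ha⟩)
  surj q := by
    obtain ⟨⟨a, b⟩, hab⟩ := IsLocalization.surj R⁰ q
    exact ⟨⟨algebraMap R S a, ⟨algebraMap R S b, algebraMap_mem_nonZeroDivisors b.2⟩⟩, hab⟩
  exists_of_eq h := ⟨1, by rw [Subtype.ext h]⟩

/-- The conductor ideal is the `R`-submodule `1 / S` of the total ring of fractions. -/
noncomputable def conductorEquiv :
    conductor S ≃ₗ[R] ↥((1 : Submodule R Q) / Subalgebra.toSubmodule S) :=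
  (Submodule.equivMapOfInjective _ (IsFractionRing.injective R Q) _).trans <|
    LinearEquiv.ofEq _ _ <| Submodule.map_comap_eq_self <|
      (one_div_le_one S.one_mem).trans_eq Submodule.one_eq_range

/-- A linear form on `S` is multiplication by an element of the conductor. -/
noncomputable def conductorEquivDual : conductor S ≃ₗ[R] Dual R S :=
  (conductorEquiv S).trans (oneDivEquivDual (Subalgebra.toSubmodule S) S.one_mem isUnit_one)

variable {S}

theorem exists_mem_conductor [Module.Finite R S] : ∃ d ∈ conductor S, d ∈ R⁰ := by
  obtain ⟨d, hd, hdS⟩ :=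
    exists_algebraMap_mem_one_div (I := Subalgebra.toSubmodule S) (Module.Finite.iff_fg.mp ‹_›)
  exact ⟨d, hdS, hd⟩

theorem conductorSubmodule_div_div_eq_self {I : Submodule S Q} [Module.Finite R I]
    [IsReflexive R I] {u : Q} (hu : u ∈ I) (hu' : IsUnit u) :
    conductorSubmodule S / (conductorSubmodule S / I) = I := by
  apply Submodule.restrictScalars_injective R
  rw [← one_div_restrictScalars, ← one_div_restrictScalars]
  have : IsReflexive R (I.restrictScalars R) := ‹IsReflexive R I›
  exact one_div_one_div_eq_self (I.restrictScalars R)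
    (Module.Finite.iff_fg.mp ‹Module.Finite R I›) hu hu'

theorem nonempty_equiv_end_conductor [Module.Finite R S] [IsReflexive R S] :
    Nonempty (S ≃ₗ[R] (conductor S →ₗ[R] conductor S)) := by
  let C := (1 : Submodule R Q) / Subalgebra.toSubmodule S
  have hCC : C / C = Subalgebra.toSubmodule S := by
    have : IsReflexive R (Subalgebra.toSubmodule S) := ‹IsReflexive R S›
    calc C / C = 1 / C := (one_div_restrictScalars S (conductorSubmodule S)).symm
      _ = Subalgebra.toSubmodule S := one_div_one_div_eq_self _
        (Module.Finite.iff_fg.mp ‹Module.Finite R S›) S.one_mem isUnit_one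
  obtain ⟨d, hdC, hd⟩ := exists_mem_conductor (S := S)
  let endEquiv := LinearEquiv.ofBijective (divToHom C C)
    (bijective_divToHom C (u := algebraMap R Q d) hdC (IsLocalization.map_units Q ⟨d, hd⟩))
  exact ⟨(LinearEquiv.ofEq _ _ hCC.symm).trans
    (endEquiv.trans ((conductorEquiv S).conj.symm))⟩

section Module

variable {M : Type*} [AddCommGroup M] [Module R M] [Module S M] [IsScalarTower R S M]

theorem map_smul_of_birational (f : M →ₗ[R] Q) (s : S) (m : M) : f (s • m) = s * f m := by
  obtain ⟨⟨a, b⟩, hab⟩ := IsLocalization.surj R⁰ (s : Q)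
  have hs : (b : R) • s = algebraMap R S a := Subtype.ext <|
    calc (b : R) • (s : Q) = s * algebraMap R Q b := by rw [Algebra.smul_def, mul_comm]
      _ = algebraMap R Q a := hab
  refine (IsLocalization.map_units Q b).mul_left_cancel ?_
  rw [← Algebra.smul_def, ← map_smul, ← smul_assoc, hs, algebraMap_smul, map_smul,
    Algebra.smul_def, ← hab]
  ring

theorem algebraMap_apply_smul (f : M →ₗ[R] R) (s : S) (m : M) :
    algebraMap R Q (f (s • m)) = s * algebraMap R Q (f m) :=
  map_smul_of_birational (S := S) (Algebra.linearMap R Q ∘ₗ f) s m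

variable (S M) in
theorem traceIdeal_le_conductor : traceIdeal R M ≤ conductor S := by
  refine iSup_le fun f => ?_
  rintro _ ⟨m, rfl⟩
  refine mem_conductor.mpr fun s hs => Submodule.mem_one.mpr ⟨f ((⟨s, hs⟩ : S) • m), ?_⟩
  rw [algebraMap_apply_smul, mul_comm]

end Module

theorem isFrobeniusForm_apply_one (e : S ≃ₗ[R] Dual R S) : IsFrobeniusForm (e 1) := by
  have he (s : S) : e 1 ∘ₗ LinearMap.mulLeft R s = e s := LinearMap.ext fun t => by
    apply IsFractionRing.injective R Q
    calc algebraMap R Q (e 1 (s * t)) = s * algebraMap R Q (e 1 t) :=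
        algebraMap_apply_smul (e 1) s t
      _ = algebraMap R Q (e (s • 1) t) :=
        (algebraMap_apply_smul (LinearMap.applyₗ t ∘ₗ e.toLinearMap) s 1).symm
      _ = algebraMap R Q (e s t) := by rw [smul_eq_mul, mul_one]
  simpa only [IsFrobeniusForm, he] using e.bijective

theorem exists_module_of_traceIdeal_le {M : Type*} [AddCommGroup M] [Module R M] [IsReflexive R M]
    (hM : traceIdeal R M ≤ conductor S) :
    ∃ _ : Module S M, IsScalarTower R S M := by
  have hinj := IsFractionRing.injective R Q
  let ι : M →ₗ[R] Dual R M →ₗ[R] Q :=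
    LinearMap.compRight R (Algebra.linearMap R Q) ∘ₗ Dual.eval R M
  refine exists_module_of_injective ι (fun m n hmn => ?_) fun s m => ?_
  · refine (bijective_dual_eval R M).1 (LinearMap.ext fun f => hinj ?_)
    exact LinearMap.congr_fun hmn f
  · have hrange (f : Dual R M) : (s • ι m) f ∈ LinearMap.range (Algebra.linearMap R Q) := by
      have hfm : f m ∈ conductor S := hM (Submodule.mem_iSup_of_mem f ⟨m, rfl⟩)
      have := mem_conductor.mp hfm s s.2
      rwa [mul_comm, Submodule.one_eq_range] at this
    let Φ : Dual R (Dual R M) :=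
      (s • ι m).codRestrictOfInjective (Algebra.linearMap R Q) hinj hrange
    obtain ⟨m', hm'⟩ := (bijective_dual_eval R M).2 Φ
    refine ⟨m', LinearMap.ext fun f => ?_⟩
    change algebraMap R Q (Dual.eval R M m' f) = _
    rw [hm']
    exact (s • ι m).codRestrictOfInjective_comp_apply (Algebra.linearMap R Q) hinj hrange f

theorem nonempty_equiv_conductor [Module.Finite R S] [IsNoetherianRing S]
    [Finite (MaximalSpectrum S)]
    (hR : ∀ I : Submodule S Q, I.FG → IsReflexive R I)
    (hS : ∀ I : Submodule S Q, I.FG → IsReflexive S I) :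
    Nonempty (S ≃ₗ[R] conductor S) := by
  let C := conductorSubmodule S
  obtain ⟨d, hd, hdR⟩ := exists_mem_conductor (S := S)
  have hdC : algebraMap R Q d ∈ C := hd
  have hdu : IsUnit (algebraMap R Q d) := IsLocalization.map_units Q ⟨d, hdR⟩
  have hdual {I : Submodule S Q} (hI : I ≤ 1) {u : Q} (hu : u ∈ I) (hu' : IsUnit u) :
      C / (C / I) = I := by
    have := hR I (fg_of_le_one hI)
    have : Module.Finite S I := Module.Finite.iff_fg.mpr (fg_of_le_one hI)
    have : Module.Finite R I := Module.Finite.trans S I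
    exact conductorSubmodule_div_div_eq_self hu hu'
  have hC : C ≤ 1 := fun q hq => by
    obtain ⟨r, rfl⟩ := Submodule.mem_one.mp (one_div_le_one S.one_mem hq)
    exact Submodule.mem_one.mpr ⟨algebraMap R S r, rfl⟩
  have hCinv : 1 / (1 / C) = C := by
    have := hS C (fg_of_le_one hC)
    exact one_div_one_div_eq_self C (fg_of_le_one hC) hdC hdu
  have hCmul : C * (1 / C) = 1 := by
    refine mul_one_div_eq_one (hdual le_rfl (Submodule.one_le.mp le_rfl) isUnit_one) hCinv
      (hdual Submodule.mul_one_div_le_one (u := algebraMap R Q d) ?_ hdu)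
    exact Submodule.le_self_mul_one_div hC hdC
  obtain ⟨e⟩ := nonempty_linearEquiv_of_mul_eq_one hCmul
  exact ⟨(e.restrictScalars R).symm.trans (conductorEquiv S).symm⟩

theorem isStable_conductor_iff [Module.Finite R S] [IsReflexive R S] :
    IsStable (conductor S) ↔ Nonempty (S ≃ₗ[R] Dual R S) := by
  obtain ⟨e⟩ := nonempty_equiv_end_conductor (S := S)
  refine ⟨fun ⟨_, ⟨f⟩⟩ => ⟨e.trans (f.symm.trans (conductorEquivDual S))⟩, fun ⟨f⟩ =>
    ⟨exists_mem_conductor, ⟨(conductorEquivDual S).trans (f.symm.trans e)⟩⟩⟩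

end Birational

section Characterization

variable {R Q : Type u} [CommRing R] [CommRing Q] [Algebra R Q] [IsFractionRing R Q]
  {S : Subalgebra R Q} [Module.Finite R S] [Ring.KrullDimLE 1 R] {x : R}

theorem memCM_iff_memRefl_and_traceIdeal_le (hx : x ∈ R⁰)
    (hxJ : x ∈ Ideal.jacobson (⊥ : Ideal R)) [IsNoetherianRing S]
    (h : ∀ (M : Type u) [AddCommGroup M] [Module R M], MemCM R S M → MemRefl R M)
    (M : Type u) [AddCommGroup M] [Module R M] :
    MemCM R S M ↔ MemRefl R M ∧ traceIdeal R M ≤ conductor S := by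
  constructor
  · intro hM
    obtain ⟨_, _, _⟩ := id hM
    exact ⟨h M hM, traceIdeal_le_conductor S M⟩
  · rintro ⟨⟨_, _⟩, htr⟩
    obtain ⟨_, _⟩ := exists_module_of_traceIdeal_le htr
    have := Module.Finite.of_restrictScalars_finite R S M
    exact memCM_of_isTorsionFree hx hxJ M

theorem nonempty_equiv_dual_of_memRefl (hx : x ∈ R⁰) (hxJ : x ∈ Ideal.jacobson (⊥ : Ideal R))
    (hS : IsGorensteinRing S)
    (h : ∀ (M : Type u) [AddCommGroup M] [Module R M], MemCM R S M → MemRefl R M) :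
    Nonempty (S ≃ₗ[R] Dual R S) := by
  have := hS.1
  have := krullDimLE_of_isIntegral (A := R) (B := S) 1
  have := finite_maximalSpectrum (A := S) (algebraMap_mem_nonZeroDivisors hx)
    (algebraMap_mem_jacobson_bot hxJ)
  have hreflR (I : Submodule S Q) (hI : I.FG) : IsReflexive R I := by
    have : Module.Finite S I := Module.Finite.iff_fg.mpr hI
    exact (h I (memCM_of_isTorsionFree hx hxJ I)).2
  have hreflS (I : Submodule S Q) (hI : I.FG) : IsReflexive S I := by
    have : Module.Finite S I := Module.Finite.iff_fg.mpr hI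
    exact hS.isReflexive_of_isTorsionFree hx hxJ I
  obtain ⟨e⟩ := nonempty_equiv_conductor hreflR hreflS
  exact ⟨e.trans (conductorEquivDual S)⟩

theorem memRefl_of_memCM (hx : x ∈ R⁰) (hxJ : x ∈ Ideal.jacobson (⊥ : Ideal R))
    (hS : IsGorensteinRing S) (e : S ≃ₗ[R] Dual R S) {M : Type u} [AddCommGroup M] [Module R M]
    (hM : MemCM R S M) : MemRefl R M := by
  have := hS.1
  obtain ⟨_, _, hM⟩ := hM
  obtain ⟨_, _⟩ := (isMCM_iff_isTorsionFree hx hxJ).mp hM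
  have := hS.isReflexive_of_isTorsionFree hx hxJ M
  exact ⟨Module.Finite.trans S M, (isFrobeniusForm_apply_one e).isReflexive M⟩

end Characterization

theorem exists_mem_jacobson_bot_of_isCohenMacaulay {R : Type*} [CommRing R] [IsLocalRing R]
    (hCM : IsCohenMacaulayLocalRing R) (hdim : ringKrullDim R = 1) :
    ∃ x ∈ R⁰, x ∈ Ideal.jacobson (⊥ : Ideal R) := by
  have hdepth : depth R R = 1 := by exact_mod_cast hCM.2.trans hdim
  obtain ⟨x, hxm, hx⟩ := one_le_depth_iff.mp hdepth.ge
  refine ⟨x, ?_, (IsLocalRing.jacobson_eq_maximalIdeal ⊥ bot_ne_top).ge hxm⟩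
  exact isRegular_iff_mem_nonZeroDivisors.mp (isLeftRegular_iff_isRegular.mp hx)

end BirationalExt

open BirationalExt Module nonZeroDivisors in
theorem corollary3p6_general {R : Type u} [CommRing R] [Ring.KrullDimLE 1 R]
    {x : R} (hx : x ∈ R⁰) (hxJ : x ∈ Ideal.jacobson (⊥ : Ideal R))
    {Q : Type u} [CommRing Q] [Algebra R Q] [IsFractionRing R Q]
    (S : Subalgebra R Q) (hfin : Module.Finite R S) (hS : IsGorensteinRing S) :
    List.TFAE [
      ∀ (M : Type u) [AddCommGroup M] [Module R M], MemCM R S M → MemRefl R M,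
      Nonempty (S ≃ₗ[R] (S →ₗ[R] R)),
      MemRefl R S ∧ IsStable (conductor S),
      ∀ (M : Type u) [AddCommGroup M] [Module R M],
        MemCM R S M ↔ (MemRefl R M ∧ traceIdeal R M ≤ conductor S)] := by
  have := hS.1
  tfae_have 1 → 2 := nonempty_equiv_dual_of_memRefl hx hxJ hS
  tfae_have 2 → 1 := fun ⟨e⟩ _ _ _ => memRefl_of_memCM hx hxJ hS e
  tfae_have 2 → 3 := fun ⟨e⟩ =>
    have hrefl := memRefl_of_memCM hx hxJ hS e (memCM_of_isTorsionFree hx hxJ S)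
    have := hrefl.2
    ⟨hrefl, isStable_conductor_iff.mpr ⟨e⟩⟩
  tfae_have 3 → 2 := fun ⟨⟨_, _⟩, hstable⟩ => isStable_conductor_iff.mp hstable
  tfae_have 1 → 4 := fun h => memCM_iff_memRefl_and_traceIdeal_le hx hxJ h
  tfae_have 4 → 1 := fun h M _ _ hM => ((h M).mp hM).1
  tfae_finish

theorem corollary3p6 {R : Type u} [CommRing R] [IsLocalRing R]
    (hCM : BirationalExt.IsCohenMacaulayLocalRing R)
    (hdim : ringKrullDim R = 1)
    (hgen : BirationalExt.IsGenericallyGorenstein R)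
    {Q : Type u} [CommRing Q] [Algebra R Q] [IsFractionRing R Q]
    (S : Subalgebra R Q) (hfin : Module.Finite R S)
    (hS : BirationalExt.IsGorensteinRing S) :
    List.TFAE [
      ∀ (M : Type u) [AddCommGroup M] [Module R M],
        BirationalExt.MemCM R S M → BirationalExt.MemRefl R M,
      Nonempty (S ≃ₗ[R] (S →ₗ[R] R)),
      BirationalExt.MemRefl R S ∧ BirationalExt.IsStable (BirationalExt.conductor S),
      ∀ (M : Type u) [AddCommGroup M] [Module R M],
        BirationalExt.MemCM R S M ↔
          (BirationalExt.MemRefl R M ∧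
            BirationalExt.traceIdeal R M ≤ BirationalExt.conductor S)] := by
  have : Ring.KrullDimLE 1 R := (Order.krullDimLE_iff _ _).mpr hdim.le
  obtain ⟨x, hx, hxJ⟩ := BirationalExt.exists_mem_jacobson_bot_of_isCohenMacaulay hCM hdim
  exact corollary3p6_general hx hxJ S hfin hS
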